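/- Let $K$ be a field of arbitrary characteristic and $n \ge 0$. A ($n$-variate) higher derivation on a commutative ring $R$ is a ring homomorphism $\theta : R \to R[[T_1,\dots,T_n]]$ with $\theta(r)|_{T=0} = r$ for all $r\in R$; write $\theta(r) = \sum_{\alpha\in\mathbb N^n} \theta^{(\alpha)}(r) T^\alpha$. It is called iterative if $\theta^{(\alpha)}\circ\theta^{(\beta)} = \binom{\alpha+\beta}{\alpha}\theta^{(\alpha+\beta)}$ for all $\alpha,\beta\in\mathbb N^n$, where $\binom{\alpha+\beta}{\alpha} = \prod_i \binom{\alpha_i+\beta_i}{\alpha_i}$. For a polynomial ring $K[t_1,\dots,t_n]$ the higher derivation $\theta_t$ with respect to $t=(t_1,\dots,t_n)$ is the $K$-algebra homomorphism with $\theta_t(t_i) = t_i + T_i$ for all $i$. Let $F/K$ be a field extension and let $s_1,\dots,s_n\in F$ be algebraically independent over $K$ such that $F/K(s_1,\dots,s_n)$ is separable algebraic. Let $\theta_s : F\to F[[T_1,\dots,T_n]]$ be the unique higher derivation on $F$ extending the higher derivation with respect to $s=(s_1,\dots,s_n)$ on $K[s_1,\dots,s_n]$. Let $R\subseteq F$ be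 a $K$-subalgebra such that $\theta_s$ restricts to a higher derivation on $R$, i.e. $\theta_s^{(\alpha)}(R)\subseteq R$ for all $\alpha\in\mathbb N^n$. Let $t_1,\dots,t_n\in R$ be such that the determinant of the Jacobian matrix $J(t,s) = \bigl(\theta_s^{(e_j)}(t_i)\bigr)_{1\le i,j\le n}$ is invertible in $R$, where $e_j\in\mathbb N^n$ is the $j$-th unit vector. Then $t_1,\dots,t_n$ are algebraically independent over $K$, and there is an iterative higher derivation on $R$ which extends the higher derivation $\theta_t$ with respect to $t$ on $K[t_1,\dots,t_n]$; it is the only higher derivation on $R$ extending $\theta_t$. -/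

import Mathlib

universe u v w

/-- A higher derivation on `R` in the variables `T_i`, `i ∈ σ`: a ring homomorphism
`θ : R → R[[T]]` such that `θ(r)|_{T = 0} = r` for all `r`.
For `σ = Fin d` this is a `d`-variate higher derivation. -/
structure HigherDerivation (σ : Type w) (R : Type v) [CommRing R] where
  toRingHom : R →+* MvPowerSeries σ R
  constantCoeff_apply : ∀ r : R, MvPowerSeries.constantCoeff (toRingHom r) = r

namespace HigherDerivation

variable {σ : Type w} {R : Type v} [CommRing R]

/-- The map `θ^(α) : R → R`, taking `r` to the coefficient of `T^α` in `θ(r)`. -/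
noncomputable def component (θ : HigherDerivation σ R) (α : σ →₀ ℕ) (r : R) : R :=
  MvPowerSeries.coeff α (θ.toRingHom r)

/-- `θ` is iterative: `θ^(α) ∘ θ^(β) = binom(α + β, α) θ^(α + β)` for all multi-indices. -/
def IsIterative [Fintype σ] (θ : HigherDerivation σ R) : Prop :=
  ∀ (α β : σ →₀ ℕ) (r : R),
    θ.component α (θ.component β r) =
      (∏ i, (α i + β i).choose (α i)) • θ.component (α + β) r

/-- `ψ` on `S` extends `θ` on `R` along `f : R → S`, that is, `ψ^(α) ∘ f = f ∘ θ^(α)` for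
all `α`. -/
def Extends {S : Type u} [CommRing S] (f : R →+* S)
    (θ : HigherDerivation σ R) (ψ : HigherDerivation σ S) : Prop :=
  ∀ (α : σ →₀ ℕ) (r : R), ψ.component α (f r) = f (θ.component α r)

/-- The higher derivation on the polynomial ring `K[X_i : i ∈ σ]` with respect to its variables:
the identity on `K`, and `X_i ↦ X_i + T_i`. -/
noncomputable def polynomial (σ : Type w) (K : Type u) [CommRing K] :
    HigherDerivation σ (MvPolynomial σ K) where
  toRingHom := MvPolynomial.eval₂Hom (MvPowerSeries.C.comp MvPolynomial.C)
    (fun i => MvPowerSeries.C (MvPolynomial.X i) + MvPowerSeries.X i)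
  constantCoeff_apply := fun p => by
    have h : (MvPowerSeries.constantCoeff.comp (MvPolynomial.eval₂Hom
        ((MvPowerSeries.C (σ := σ)).comp (MvPolynomial.C (σ := σ) (R := K)))
        (fun i => MvPowerSeries.C (MvPolynomial.X i) + MvPowerSeries.X i)))
        = RingHom.id (MvPolynomial σ K) := by
      apply MvPolynomial.ringHom_ext <;> intro x <;> simp
    exact congrArg (fun g => g p) h

theorem extends_iff {S : Type u} [CommRing S] {f : R →+* S}
    {θ : HigherDerivation σ R} {ψ : HigherDerivation σ S} :
    Extends f θ ψ ↔ ∀ r, ψ.toRingHom (f r) = MvPowerSeries.map f (θ.toRingHom r) := by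
  constructor
  · intro h r
    ext α
    simpa [component] using h α r
  · intro h α r
    simp [component, h r]

theorem mem_span_range_X [Finite σ] (p : MvPowerSeries σ R)
    (hp : MvPowerSeries.constantCoeff p = 0) :
    p ∈ Ideal.span (Set.range (MvPowerSeries.X (σ := σ) (R := R))) := by
  classical
  cases nonempty_fintype σ
  have hex : ∀ α : σ →₀ ℕ, ∃ g : Option σ, (α = 0 ∧ g = none) ∨ ∃ i, g = some i ∧ α i ≠ 0 := by
    intro α
    by_cases h : α = 0
    · exact ⟨none, Or.inl ⟨h, rfl⟩⟩
    · obtain ⟨i, hi⟩ := Finsupp.ne_iff.mp h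
      exact ⟨some i, Or.inr ⟨i, rfl, hi⟩⟩
  choose g hg using hex
  let q : σ → MvPowerSeries σ R := fun i β =>
    if g (β + Finsupp.single i 1) = some i then
      MvPowerSeries.coeff (β + Finsupp.single i 1) p else 0
  have hpq : p = ∑ i, q i * MvPowerSeries.X i := by
    ext α
    have hterm : ∀ i, MvPowerSeries.coeff α (q i * MvPowerSeries.X i) =
        if g α = some i then MvPowerSeries.coeff α p else 0 := by
      intro i
      rw [MvPowerSeries.X, MvPowerSeries.coeff_mul_monomial, mul_one]
      by_cases h : Finsupp.single i 1 ≤ α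
      · rw [if_pos h]
        change (if g (α - Finsupp.single i 1 + Finsupp.single i 1) = some i then
          MvPowerSeries.coeff (α - Finsupp.single i 1 + Finsupp.single i 1) p else 0) = _
        rw [tsub_add_cancel_of_le h]
      · rw [if_neg h, if_neg]
        intro hgi
        apply h
        rcases hg α with ⟨_, h2⟩ | ⟨j, h2, h3⟩
        · rw [h2] at hgi
          cases hgi
        · rw [h2] at hgi
          cases hgi
          rw [Finsupp.single_le_iff]
          omega
    rw [map_sum, Finset.sum_congr rfl (fun i _ => hterm i)]
    rcases hg α with ⟨h1, h2⟩ | ⟨j, h2, h3⟩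
    · subst h1
      have hp' : MvPowerSeries.coeff 0 p = 0 := hp
      simp [h2, hp']
    · simp [h2]
  rw [hpq]
  exact Ideal.sum_mem _ fun i _ =>
    Ideal.mul_mem_left _ _ (Ideal.subset_span ⟨i, rfl⟩)

/-- A higher derivation extends uniquely along a formally étale ring homomorphism. -/
theorem existsUnique_extends [Finite σ] {S : Type u} [CommRing S] {f : R →+* S}
    (hf : f.FormallyEtale) (θ : HigherDerivation σ R) :
    ∃! ψ : HigherDerivation σ S, Extends f θ ψ := by
  let _ : Algebra R S := f.toAlgebra
  have _ : Algebra.FormallyEtale R S := hf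
  let _ : Algebra R (MvPowerSeries σ S) :=
    ((MvPowerSeries.map f).comp θ.toRingHom).toAlgebra
  have halg : ∀ r, algebraMap R (MvPowerSeries σ S) r =
    MvPowerSeries.map f (θ.toRingHom r) := fun _ => rfl
  have halg' : ∀ r, algebraMap R S r = f r := fun _ => rfl
  let J : Ideal (MvPowerSeries σ S) := Ideal.span (Set.range MvPowerSeries.X)
  have hJ0 : ∀ p ∈ J, MvPowerSeries.constantCoeff p = 0 := by
    intro p hp
    have hle : J ≤ RingHom.ker (MvPowerSeries.constantCoeff (σ := σ) (R := S)) := by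
      apply Ideal.span_le.mpr
      rintro _ ⟨i, rfl⟩
      simp [RingHom.mem_ker]
    exact hle hp
  have hcc : ∀ r, MvPowerSeries.constantCoeff (MvPowerSeries.map f (θ.toRingHom r)) = f r := by
    intro r
    rw [MvPowerSeries.constantCoeff_map, θ.constantCoeff_apply]
  let φ : S →ₐ[R] MvPowerSeries σ S ⧸ J :=
    { (Ideal.Quotient.mk J).comp MvPowerSeries.C with
      commutes' := by
        intro r
        change Ideal.Quotient.mk J (MvPowerSeries.C (algebraMap R S r)) =
          Ideal.Quotient.mk J (algebraMap R (MvPowerSeries σ S) r)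
        rw [Ideal.Quotient.eq]
        apply mem_span_range_X
        rw [halg, halg', map_sub, hcc, MvPowerSeries.constantCoeff_C, sub_self] }
  have hJc : IsAdicComplete J (MvPowerSeries σ S) := inferInstance
  obtain ⟨g, hg⟩ := Algebra.FormallySmooth.exists_mkₐ_comp_eq_of_isAdicComplete φ
  have hgc : ∀ x, MvPowerSeries.constantCoeff (g x) = x := by
    intro x
    have h1 : Ideal.Quotient.mk J (g x) = Ideal.Quotient.mk J (MvPowerSeries.C x) :=
      congrArg (fun h => h x) hg
    have h2 := hJ0 _ (Ideal.Quotient.eq.mp h1)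
    rw [map_sub, MvPowerSeries.constantCoeff_C, sub_eq_zero] at h2
    exact h2
  refine ⟨⟨g, hgc⟩, extends_iff.mpr fun r => g.commutes r, ?_⟩
  rintro ⟨ψ, hψ⟩ hext
  have hext' := extends_iff.mp hext
  let ψ' : S →ₐ[R] MvPowerSeries σ S := { ψ with commutes' := hext' }
  have hinf : ⨅ i, J ^ i = ⊥ := by
    have := IsHausdorff.iInf_pow_smul (I := J) (M := MvPowerSeries σ S) hJc.toIsHausdorff
    simpa using this
  have heq : ψ' = g := by
    apply Algebra.FormallyUnramified.ext_of_iInf J hinf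
    intro x
    rw [Ideal.Quotient.eq]
    apply mem_span_range_X
    rw [map_sub, hgc, sub_eq_zero]
    exact hψ x
  congr 1
  exact RingHom.ext fun x => congrArg (fun h => h x) heq

/-- The higher derivation `θ_t` with respect to `t = (t_i)` on a `K`-algebra `R` that is formally
étale over the polynomial ring `K[X_i]` via `X_i ↦ t_i`: the unique extension to `R` of the
higher derivation of the polynomial ring with respect to its variables. -/
noncomputable def ofEtale [Finite σ] {K : Type u} [CommRing K] [Algebra K R] (t : σ → R)
    (ht : (MvPolynomial.aeval t : MvPolynomial σ K →ₐ[K] R).toRingHom.FormallyEtale) :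
    HigherDerivation σ R :=
  (existsUnique_extends ht (polynomial σ K)).choose

theorem extends_ofEtale [Finite σ] {K : Type u} [CommRing K] [Algebra K R] (t : σ → R)
    (ht : (MvPolynomial.aeval t : MvPolynomial σ K →ₐ[K] R).toRingHom.FormallyEtale) :
    Extends (MvPolynomial.aeval t : MvPolynomial σ K →ₐ[K] R).toRingHom
      (polynomial σ K) (ofEtale t ht) :=
  (existsUnique_extends ht (polynomial σ K)).choose_spec.1

/-- The Jacobian matrix of `f = (f_i)` with respect to a higher derivation `θ`, with entries the
first order components `θ^(e_j)(f_i)`. For `θ = θ_s` this is `J(f, s)`. -/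
noncomputable def jacobian {ι : Type*} (θ : HigherDerivation σ R) (f : ι → R) : Matrix ι σ R :=
  Matrix.of fun i j => θ.component (Finsupp.single j 1) (f i)

end HigherDerivation

open scoped IntermediateField.algebraAdjoinAdjoin in
/-- If `s` is algebraically independent over `K` and `F` is separable algebraic over `K(s)`, then
`F` is formally étale over the polynomial ring `K[s]`. -/
theorem formallyEtale_aeval_of_isSeparable {σ : Type w} {K : Type u} {F : Type v} [Field K]
    [Field F] [Algebra K F] {s : σ → F} (hs : AlgebraicIndependent K s)
    (hF : Algebra.IsSeparable (IntermediateField.adjoin K (Set.range s)) F) :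
    (MvPolynomial.aeval s : MvPolynomial σ K →ₐ[K] F).toRingHom.FormallyEtale := by
  let E := IntermediateField.adjoin K (Set.range s)
  let A := Algebra.adjoin K (Set.range s)
  have h1 : Algebra.FormallyEtale E F := Algebra.FormallyEtale.of_isSeparable E F
  have h2 : Algebra.FormallyEtale A E :=
    Algebra.FormallyEtale.of_isLocalization (nonZeroDivisors A)
  have h3 : Algebra.FormallyEtale A F := Algebra.FormallyEtale.comp A E F
  have h4 : (algebraMap A F).FormallyEtale := RingHom.formallyEtale_algebraMap.mpr h3
  have h5 : (hs.aevalEquiv : MvPolynomial σ K ≃ₐ[K] A).toRingEquiv.toRingHom.FormallyEtale :=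
    (RingHom.Etale.of_bijective hs.aevalEquiv.bijective).formallyEtale
  have h6 := h5.comp h4
  have h7 : (algebraMap A F).comp hs.aevalEquiv.toRingEquiv.toRingHom =
      (MvPolynomial.aeval s : MvPolynomial σ K →ₐ[K] F).toRingHom :=
    RingHom.ext fun p => hs.algebraMap_aevalEquiv p
  rwa [h7] at h6

/-! Existence is a change of variables. Let `θ` be the restriction of `θ_s` to `R`. The linear
substitution given by the inverse Jacobian, which has entries in `R`, turns `θ(t_i)` into `t_i +
a_i` with `a_i = T_i +` (order at least 2). The substitution `T_i ↦ a_i` is then an automorphism of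
`R⟦T⟧` (`bijective_substAlgHom`). Composing `θ` with the linear substitution and the inverse of this
automorphism gives `ψ` with `ψ(t_i) = t_i + T_i`.

Uniqueness and iterativity come from one rigidity statement
(`RingHom.eq_of_comp_eq_of_isSeparable`): by Taylor expansion of a separable equation, a lift of `R
⊆ F` to a domain is determined by its values on `K` and `t`, provided `F` is separable algebraic
over `K(t)`. Iterativity is the equality of two such lifts to `R⟦T⟧⟦U⟧`: `ψ` applied to the
coefficients of `ψ(r)`, and `ψ(r)` evaluated at `T + U`.

Separability over `K(t)` is the Jacobian criterion (`isSeparable_adjoin_of_det_ne_zero`). Algebraic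
independence of `t` follows by counting transcendence degree. -/

namespace MvPowerSeries

/-! ### Order estimates and substitutions tangent to the identity -/

variable {σ : Type w} {R : Type v} [CommRing R]

theorem le_order_sub {p q : MvPowerSeries σ R} {m : ℕ∞} (hp : m ≤ p.order) (hq : m ≤ q.order) :
    m ≤ (p - q).order := by
  rw [sub_eq_add_neg]
  exact (le_min hp (by rwa [order_neg])).trans min_order_le_add

theorem eq_zero_of_forall_le_order {p : MvPowerSeries σ R} (h : ∀ m : ℕ, (m : ℕ∞) ≤ p.order) :
    p = 0 := by
  rw [← order_eq_top_iff]
  exact ENat.eq_top_iff_forall_ge.mpr h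

/-- `x` and `y` have order at least `m` and the same homogeneous part of degree `m`. -/
structure SameLeadingPart (m : ℕ) (x y : MvPowerSeries σ R) : Prop where
  left : (m : ℕ∞) ≤ x.order
  right : (m : ℕ∞) ≤ y.order
  sub : ((m + 1 : ℕ) : ℕ∞) ≤ (x - y).order

theorem SameLeadingPart.one : SameLeadingPart 0 (1 : MvPowerSeries σ R) 1 :=
  ⟨by simp, by simp, by simp⟩

theorem SameLeadingPart.mul {m n : ℕ} {x y x' y' : MvPowerSeries σ R}
    (h : SameLeadingPart m x y) (h' : SameLeadingPart n x' y') :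
    SameLeadingPart (m + n) (x * x') (y * y') := by
  refine ⟨?_, ?_, ?_⟩
  · push_cast
    exact (add_le_add h.left h'.left).trans le_order_mul
  · push_cast
    exact (add_le_add h.right h'.right).trans le_order_mul
  · have e : x * x' - y * y' = (x - y) * x' + y * (x' - y') := by ring
    rw [e]
    refine (le_min ?_ ?_).trans min_order_le_add
    · refine le_trans ?_ ((add_le_add h.sub h'.left).trans le_order_mul)
      norm_cast; omega
    · refine le_trans ?_ ((add_le_add h.right h'.sub).trans le_order_mul)
      norm_cast

theorem SameLeadingPart.pow {m : ℕ} {x y : MvPowerSeries σ R}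
    (h : SameLeadingPart m x y) (k : ℕ) : SameLeadingPart (k * m) (x ^ k) (y ^ k) := by
  induction k with
  | zero => simpa using SameLeadingPart.one
  | succ k ih =>
    rw [pow_succ, pow_succ, Nat.succ_mul]
    exact ih.mul h

theorem SameLeadingPart.prod {ι : Type*} (s : Finset ι) {m : ι → ℕ} {x y : ι → MvPowerSeries σ R}
    (h : ∀ i ∈ s, SameLeadingPart (m i) (x i) (y i)) :
    SameLeadingPart (∑ i ∈ s, m i) (∏ i ∈ s, x i) (∏ i ∈ s, y i) := by
  classical
  induction s using Finset.induction_on with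
  | empty => simpa using SameLeadingPart.one
  | insert i s hi ih =>
    rw [Finset.sum_insert hi, Finset.prod_insert hi, Finset.prod_insert hi]
    exact (h i (Finset.mem_insert_self i s)).mul
      (ih fun j hj => h j (Finset.mem_insert_of_mem hj))

section Subst

variable {a : σ → MvPowerSeries σ R}

theorem sameLeadingPart_X (h2 : ∀ i, 2 ≤ (a i - X i).order) (i : σ) :
    SameLeadingPart 1 (a i) (X i) := by
  have hX : ((1 : ℕ) : ℕ∞) ≤ (X i : MvPowerSeries σ R).order := by
    rw [Nat.cast_one, one_le_order_iff_constCoeff_eq_zero]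
    simp
  refine ⟨?_, hX, by simpa using h2 i⟩
  have e : a i = (a i - X i) + X i := by ring
  rw [e]
  exact (le_min (le_trans (by norm_cast) (h2 i)) hX).trans min_order_le_add

theorem constantCoeff_eq_zero_of_order_sub_X (h2 : ∀ i, 2 ≤ (a i - X i).order) (i : σ) :
    constantCoeff (a i) = 0 := by
  rw [← one_le_order_iff_constCoeff_eq_zero]
  simpa using (sameLeadingPart_X h2 i).left

theorem sameLeadingPart_monomial (h2 : ∀ i, 2 ≤ (a i - X i).order) (d : σ →₀ ℕ) :
    SameLeadingPart d.degree (d.prod fun i k => a i ^ k) (monomial d (1 : R)) := by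
  have h := SameLeadingPart.prod d.support (m := fun i => d i * 1)
    (x := fun i => a i ^ d i) (y := fun i => (X i : MvPowerSeries σ R) ^ d i)
    fun i _ => (sameLeadingPart_X h2 i).pow (d i)
  simp only [mul_one] at h
  rw [monomial_one_eq]
  exact h

/-- Substituting series `a_i = X_i + (terms of order ≥ 2)` does not change the leading part. -/
theorem le_order_sub_subst [Finite σ] (h2 : ∀ i, 2 ≤ (a i - X i).order)
    {p : MvPowerSeries σ R} {m : ℕ} (hp : (m : ℕ∞) ≤ p.order) :
    ((m + 1 : ℕ) : ℕ∞) ≤ (p - subst a p).order := by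
  have ha : HasSubst a :=
    hasSubst_of_constantCoeff_zero (constantCoeff_eq_zero_of_order_sub_X h2)
  refine nat_le_order fun e he => ?_
  -- Here `e` has degree at most `m`. Monomials of degree below `m` do not occur in `p`; for the
  -- others, substitution changes only degrees above `m`, which are invisible at `e`.
  have hcoeff : ∀ d : σ →₀ ℕ, coeff d p = 0 ∨
      coeff e (d.prod fun i k => a i ^ k) = coeff e (monomial d (1 : R)) := by
    intro d
    by_cases hd : d.degree < m
    · left
      exact coeff_of_lt_order (lt_of_lt_of_le (by exact_mod_cast hd) hp)
    · right
      rw [← sub_eq_zero, ← map_sub]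
      refine coeff_of_lt_order (lt_of_lt_of_le ?_ (sameLeadingPart_monomial h2 d).sub)
      norm_cast; omega
  classical
  rw [map_sub, coeff_subst ha, sub_eq_zero, finsum_eq_single _ e]
  · rcases hcoeff e with h | h
    · rw [h, zero_smul]
    · rw [h, coeff_monomial_same, smul_eq_mul, mul_one]
  · intro d hd
    rcases hcoeff d with h | h
    · rw [h, zero_smul]
    · rw [h, coeff_monomial_ne hd.symm, smul_zero]

end Subst

/-- An additive endomorphism of `R⟦X⟧` that differs from the identity by an order raising map is
bijective. -/
theorem bijective_of_le_order_sub (φ : AddMonoid.End (MvPowerSeries σ R))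
    (h : ∀ (p : MvPowerSeries σ R) (m : ℕ), (m : ℕ∞) ≤ p.order →
      ((m + 1 : ℕ) : ℕ∞) ≤ (p - φ p).order) : Function.Bijective φ := by
  -- Since `N` raises the order, the geometric series `∑ N ^ k` converges coefficientwise and
  -- inverts `φ = 1 - N`.
  let N : AddMonoid.End (MvPowerSeries σ R) := 1 - φ
  have hN : ∀ p, N p = p - φ p := fun _ => rfl
  have hNpow : ∀ (k : ℕ) (p : MvPowerSeries σ R), (k : ℕ∞) ≤ ((N ^ k) p).order := by
    intro k p
    induction k with
    | zero => simp
    | succ k ih =>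
      rw [pow_succ']
      change _ ≤ (N ((N ^ k) p)).order
      rw [hN]
      exact h _ _ ih
  have hφ : ∀ (p : MvPowerSeries σ R) (m : ℕ), (m : ℕ∞) ≤ p.order → (m : ℕ∞) ≤ (φ p).order := by
    intro p m hp
    have e : φ p = p - (p - φ p) := by abel
    rw [e]
    exact le_order_sub hp (le_trans (by norm_cast; omega) (h p m hp))
  refine ⟨?_, fun p => ?_⟩
  · rw [injective_iff_map_eq_zero]
    intro p hp
    refine eq_zero_of_forall_le_order fun m => ?_
    induction m with
    | zero => simp
    | succ m ih => simpa [hp] using h p m ih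
  · let S : ℕ → MvPowerSeries σ R := fun m => (∑ k ∈ Finset.range m, N ^ k) p
    have hS : ∀ m, φ (S m) = p - (N ^ m) p := by
      intro m
      have e : φ = 1 - N := by simp [N]
      have h1 := mul_neg_geom_sum N m
      rw [← e] at h1
      exact congrArg (fun f : AddMonoid.End (MvPowerSeries σ R) => f p) h1
    have hSS : ∀ k l : ℕ, (k : ℕ∞) ≤ (S (k + l) - S k).order := by
      intro k l
      induction l with
      | zero => simp
      | succ l ih =>
        have e : S (k + (l + 1)) - S k = (S (k + l) - S k) + (N ^ (k + l)) p := by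
          have e' : S (k + (l + 1)) = S (k + l) + (N ^ (k + l)) p :=
            congrArg (fun f : AddMonoid.End (MvPowerSeries σ R) => f p)
              (Finset.sum_range_succ (fun k => N ^ k) (k + l))
          rw [e']
          abel
        rw [e]
        refine (le_min ih ?_).trans min_order_le_add
        exact le_trans (by norm_cast; omega) (hNpow (k + l) p)
    -- The limit of the partial sums: `(N ^ k) p` has order at least `k`, so the last term that can
    -- affect the coefficient at `d` is `k = d.degree`, hence the `+ 1`.
    let q : MvPowerSeries σ R := fun d => coeff d (S (d.degree + 1))
    have hq : ∀ d, coeff d q = coeff d (S (d.degree + 1)) := fun _ => rfl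
    have hqS : ∀ m : ℕ, (m : ℕ∞) ≤ (q - S m).order := by
      intro m
      refine nat_le_order fun d hd => ?_
      obtain ⟨l, rfl⟩ := Nat.exists_eq_add_of_le (Nat.succ_le_of_lt hd)
      rw [map_sub, hq, ← neg_sub, ← map_sub, neg_eq_zero]
      refine coeff_of_lt_order (lt_of_lt_of_le ?_ (hSS (d.degree + 1) l))
      norm_cast; omega
    refine ⟨q, ?_⟩
    rw [← sub_eq_zero]
    refine eq_zero_of_forall_le_order fun m => ?_
    have e : φ q - p = φ (q - S m) - (N ^ m) p := by
      rw [map_sub, hS]; abel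
    rw [e]
    exact le_order_sub (hφ _ _ (hqS m)) (hNpow m p)

theorem bijective_substAlgHom [Finite σ] {a : σ → MvPowerSeries σ R}
    (h2 : ∀ i, 2 ≤ (a i - X i).order) (ha : HasSubst a) :
    Function.Bijective (substAlgHom ha : MvPowerSeries σ R →ₐ[R] MvPowerSeries σ R) := by
  refine bijective_of_le_order_sub
    ((substAlgHom ha : MvPowerSeries σ R →ₐ[R] MvPowerSeries σ R) :
      MvPowerSeries σ R →+ MvPowerSeries σ R) fun p m hp => ?_
  have := le_order_sub_subst h2 hp
  rwa [← substAlgHom_apply ha] at this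

theorem constantCoeff_substAlgHom {τ : Type*} {a : σ → MvPowerSeries τ R} (ha : HasSubst a)
    (h0 : ∀ i, constantCoeff (a i) = 0) (p : MvPowerSeries σ R) :
    constantCoeff (substAlgHom (R := R) ha p) = constantCoeff p := by
  have h1 : constantCoeff (subst a (p - C (constantCoeff p))) = 0 :=
    constantCoeff_subst_eq_zero ha h0 (by simp)
  rw [← substAlgHom_apply ha, map_sub, map_sub] at h1
  have h2 : substAlgHom (R := R) ha (C (constantCoeff p)) = C (constantCoeff p) :=
    (substAlgHom (R := R) ha).commutes _
  rw [h2, constantCoeff_C, sub_eq_zero] at h1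
  exact h1

theorem order_le_order_substAlgHom {τ : Type*} {a : σ → MvPowerSeries τ R} (ha : HasSubst a)
    (h0 : ∀ i, constantCoeff (a i) = 0) (p : MvPowerSeries σ R) :
    p.order ≤ (substAlgHom (R := R) ha p).order := by
  rw [substAlgHom_apply ha]
  refine le_trans ?_ (le_order_subst ha p)
  have : 1 ≤ ⨅ i, (a i).order :=
    le_iInf fun i => one_le_order_iff_constCoeff_eq_zero.mpr (h0 i)
  simpa using mul_le_mul_left this p.order

end MvPowerSeries

/-! ### Straightening a higher derivation by a change of variables -/

namespace HigherDerivation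

open MvPowerSeries

variable {σ : Type w} {R : Type v} [CommRing R]

theorem two_le_order_sub_linear [Fintype σ] (θ : HigherDerivation σ R) (r : R) :
    2 ≤ (θ.toRingHom r - C r -
      ∑ j, θ.component (Finsupp.single j 1) r • (X j : MvPowerSeries σ R)).order := by
  classical
  refine nat_le_order (n := 2) fun d hd => ?_
  have hX : ∀ j : σ, coeff (0 : σ →₀ ℕ) (X j : MvPowerSeries σ R) = 0 := fun j =>
    coeff_zero_X j
  rcases Nat.lt_succ_iff.mp hd |>.lt_or_eq with h | h
  · have h0 : d = 0 := by
      rw [← Finsupp.degree_eq_zero_iff]; omega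
    subst h0
    simp [θ.constantCoeff_apply]
  · obtain ⟨j, rfl⟩ : d ∈ Set.range fun j : σ => Finsupp.single j 1 := by
      rw [Finsupp.range_single_one]
      exact h
    have hC : coeff (Finsupp.single j 1) (C r : MvPowerSeries σ R) = 0 := by
      rw [coeff_C, if_neg]; simp
    simp [hC, coeff_X, Finsupp.single_left_inj, component]

/-- If the Jacobian of `t` with respect to a higher derivation is invertible, then there is a
higher derivation with `t_i ↦ t_i + T_i` that is trivial on the constants of the given one. -/
theorem exists_higherDerivation_of_isUnit_det_jacobian [Fintype σ] [DecidableEq σ]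
    (θ : HigherDerivation σ R)
    (t : σ → R) (hJ : IsUnit (θ.jacobian t).det) :
    ∃ ψ : HigherDerivation σ R, (∀ i, ψ.toRingHom (t i) = C (t i) + X i) ∧
      ∀ c, θ.toRingHom c = C c → ψ.toRingHom c = C c := by
  let J := θ.jacobian t
  -- The inverse Jacobian makes the linear part of `L (θ (t i))` equal to `X i`.
  let b : σ → MvPowerSeries σ R := fun j => ∑ k, J⁻¹ j k • X k
  have hb0 : ∀ j, constantCoeff (b j) = 0 := by
    intro j
    simp [b]
  have hb : HasSubst b := hasSubst_of_constantCoeff_zero hb0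
  let L : MvPowerSeries σ R →ₐ[R] MvPowerSeries σ R := substAlgHom hb
  have hLX : ∀ j, L (X j) = b j := fun j => substAlgHom_X hb j
  have hLC : ∀ r, L (C r) = C r := fun r => L.commutes r
  let a : σ → MvPowerSeries σ R := fun i => L (θ.toRingHom (t i)) - C (t i)
  have h2 : ∀ i, 2 ≤ (a i - X i).order := by
    intro i
    have hlin : ∑ j, θ.component (Finsupp.single j 1) (t i) • b j = X i := by
      have : ∀ k, ∑ j, J i j * J⁻¹ j k = (1 : Matrix σ σ R) i k := by
        intro k
        rw [← Matrix.mul_nonsing_inv J hJ, Matrix.mul_apply]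
      calc ∑ j, θ.component (Finsupp.single j 1) (t i) • b j
          = ∑ k, (∑ j, J i j * J⁻¹ j k) • (X k : MvPowerSeries σ R) := by
            simp only [b, Finset.smul_sum, smul_smul, Finset.sum_smul]
            rw [Finset.sum_comm]
            rfl
        _ = X i := by simp [this, Matrix.one_apply]
    have e : a i - X i = L (θ.toRingHom (t i) - C (t i) -
        ∑ j, θ.component (Finsupp.single j 1) (t i) • (X j : MvPowerSeries σ R)) := by
      rw [map_sub, map_sub, map_sum, hLC]
      simp only [map_smul, hLX, hlin, a]
    rw [e]
    exact (two_le_order_sub_linear θ (t i)).trans (order_le_order_substAlgHom hb hb0 _)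
  have ha0 := constantCoeff_eq_zero_of_order_sub_X h2
  have ha : HasSubst a := hasSubst_of_constantCoeff_zero ha0
  let φ : MvPowerSeries σ R ≃ₐ[R] MvPowerSeries σ R :=
    AlgEquiv.ofBijective (substAlgHom ha) (bijective_substAlgHom h2 ha)
  have hφX : ∀ i, φ (X i) = a i := fun i => substAlgHom_X ha i
  have hφC : ∀ r, φ (C r) = C r := fun r => φ.commutes r
  have hφ0 : ∀ p, constantCoeff (φ p) = constantCoeff p := constantCoeff_substAlgHom ha ha0
  -- The witness is `φ⁻¹ ∘ L ∘ θ`: by the choice of `a`, `φ` sends `C (t i) + X i` to `L (θ (t i))`.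
  refine ⟨⟨((φ.symm : MvPowerSeries σ R →+* MvPowerSeries σ R).comp
    (L : MvPowerSeries σ R →+* MvPowerSeries σ R)).comp θ.toRingHom, fun r => ?_⟩,
    fun i => ?_, fun c hc => ?_⟩
  · change constantCoeff (φ.symm (L (θ.toRingHom r))) = r
    rw [← hφ0, AlgEquiv.apply_symm_apply, constantCoeff_substAlgHom hb hb0,
      θ.constantCoeff_apply]
  · change φ.symm (L (θ.toRingHom (t i))) = _
    rw [AlgEquiv.symm_apply_eq, map_add, hφX, hφC]
    simp [a]
  · change φ.symm (L (θ.toRingHom c)) = _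
    rw [AlgEquiv.symm_apply_eq, hc, hLC, hφC]

end HigherDerivation

/-! ### Multivariate Taylor expansion as a ring homomorphism -/

namespace MvPowerSeries

variable {σ : Type w} [Fintype σ] {R : Type v} [CommRing R]

/-- Vandermonde's identity for multi-indices. -/
theorem _root_.Finsupp.prod_add_choose_eq [DecidableEq σ] (g h α : σ →₀ ℕ) :
    ∏ i, (g i + h i).choose (α i) =
      ∑ a ∈ Finset.HasAntidiagonal.antidiagonal α,
        (∏ i, (g i).choose (a.1 i)) * ∏ i, (h i).choose (a.2 i) := by
  simp only [Nat.add_choose_eq, Finset.prod_univ_sum, ← Finset.prod_mul_distrib]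
  symm
  refine Finset.sum_bij' (fun a _ i => (a.1 i, a.2 i))
    (fun p _ => (Finsupp.equivFunOnFinite.symm fun i => (p i).1,
      Finsupp.equivFunOnFinite.symm fun i => (p i).2)) ?_ ?_ ?_ ?_ ?_
  · intro a ha
    rw [Finset.HasAntidiagonal.mem_antidiagonal] at ha
    simp [Fintype.mem_piFinset, ← ha]
  · intro p hp
    simp only [Fintype.mem_piFinset, Finset.HasAntidiagonal.mem_antidiagonal] at hp ⊢
    ext i
    simpa using hp i
  · intro a _
    ext <;> simp
  · intro p _
    ext <;> simp
  · intro a _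
    rfl

/-- The power series `p(T + U)` in `U` over `R⟦T⟧`. -/
noncomputable def taylorSeries (p : MvPowerSeries σ R) : MvPowerSeries σ (MvPowerSeries σ R) :=
  fun β α => (∏ i, (α i + β i).choose (α i)) • coeff (α + β) p

theorem coeff_coeff_taylorSeries (p : MvPowerSeries σ R) (α β : σ →₀ ℕ) :
    coeff α (coeff β (taylorSeries p)) =
      (∏ i, (α i + β i).choose (α i)) • coeff (α + β) p := rfl

/-- Taylor expansion `p(T) ↦ p(T + U)`, as a power series in `U` over `R⟦T⟧`. -/
noncomputable def taylor (σ : Type w) [Fintype σ] (R : Type v) [CommRing R] :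
    MvPowerSeries σ R →+* MvPowerSeries σ (MvPowerSeries σ R) where
  toFun := taylorSeries
  map_one' := by
    classical
    refine MvPowerSeries.ext fun β => MvPowerSeries.ext fun α => ?_
    rw [coeff_coeff_taylorSeries]
    simp only [coeff_one, add_eq_zero, apply_ite (coeff α), map_zero]
    by_cases hα : α = 0 <;> by_cases hβ : β = 0 <;> simp [hα, hβ]
  map_zero' := by
    refine MvPowerSeries.ext fun β => MvPowerSeries.ext fun α => ?_
    rw [coeff_coeff_taylorSeries]
    simp
  map_add' p q := by
    refine MvPowerSeries.ext fun β => MvPowerSeries.ext fun α => ?_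
    simp only [map_add, coeff_coeff_taylorSeries, smul_add]
  map_mul' p q := by
    classical
    refine MvPowerSeries.ext fun β => MvPowerSeries.ext fun α => ?_
    rw [coeff_coeff_taylorSeries, coeff_mul β, map_sum]
    simp only [coeff_mul α, coeff_coeff_taylorSeries]
    -- The double sum over splittings of `β` and `α` is regrouped by the total exponents `g` that
    -- fall to `p` and to `q`.
    rw [coeff_mul, Finset.smul_sum, ← Finset.sum_product',
      ← Finset.sum_fiberwise_of_maps_to (s := Finset.HasAntidiagonal.antidiagonal β ×ˢ Finset.HasAntidiagonal.antidiagonal α)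
        (t := Finset.HasAntidiagonal.antidiagonal (α + β))
        (g := fun x => (x.2.1 + x.1.1, x.2.2 + x.1.2))]
    · refine Finset.sum_congr rfl fun g hg => ?_
      rw [Finset.HasAntidiagonal.mem_antidiagonal] at hg
      have hα : ∀ i, α i + β i = g.1 i + g.2 i := fun i => by
        rw [← Finsupp.add_apply, ← hg, Finsupp.add_apply]
      -- For fixed `g`, the splitting of `α` determines that of `β` by subtraction. Splittings of
      -- `α` not bounded by `g` have a vanishing binomial coefficient, so this is Vandermonde's
      -- identity.
      have hV : ∏ i, (α i + β i).choose (α i) =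
          ∑ x ∈ Finset.HasAntidiagonal.antidiagonal β ×ˢ Finset.HasAntidiagonal.antidiagonal α with
            (x.2.1 + x.1.1, x.2.2 + x.1.2) = g,
          (∏ i, (x.2.1 i + x.1.1 i).choose (x.2.1 i)) *
            ∏ i, (x.2.2 i + x.1.2 i).choose (x.2.2 i) := by
        simp only [hα]
        rw [Finsupp.prod_add_choose_eq]
        symm
        refine Finset.sum_of_injOn (fun x => x.2) ?_ ?_ ?_ ?_
        · rintro ⟨⟨b1, b2⟩, a1, a2⟩ h ⟨⟨b1', b2'⟩, a1', a2'⟩ h' he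
          simp only [Finset.mem_coe, Finset.mem_filter] at h h' he
          obtain ⟨h1, h2⟩ := Prod.ext_iff.mp (h.2.trans h'.2.symm)
          obtain ⟨rfl, rfl⟩ := Prod.ext_iff.mp he
          have h1' := add_left_cancel h1
          have h2' := add_left_cancel h2
          rw [h1', h2']
        · intro x hx
          simp only [Finset.mem_coe, Finset.mem_filter, Finset.mem_product] at hx
          exact hx.1.2
        · intro a ha hna
          rw [Finset.HasAntidiagonal.mem_antidiagonal] at ha
          by_contra hne
          rw [mul_eq_zero, not_or, Finset.prod_eq_zero_iff, Finset.prod_eq_zero_iff] at hne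
          have h1 : a.1 ≤ g.1 := fun i => by
            by_contra hlt
            exact hne.1 ⟨i, Finset.mem_univ i, Nat.choose_eq_zero_of_lt (not_le.mp hlt)⟩
          have h2 : a.2 ≤ g.2 := fun i => by
            by_contra hlt
            exact hne.2 ⟨i, Finset.mem_univ i, Nat.choose_eq_zero_of_lt (not_le.mp hlt)⟩
          refine hna ⟨((g.1 - a.1, g.2 - a.2), a), ?_, rfl⟩
          simp only [Finset.mem_coe, Finset.mem_filter, Finset.mem_product,
            Finset.HasAntidiagonal.mem_antidiagonal, add_tsub_cancel_of_le h1, add_tsub_cancel_of_le h2, ha,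
            and_true]
          ext i
          have e1 := hα i
          have e2 := h1 i
          have e3 := h2 i
          have e4 : a.1 i + a.2 i = α i := by rw [← ha]; rfl
          simp only [Finsupp.add_apply, Finsupp.tsub_apply]
          omega
        · intro x hx
          obtain ⟨rfl⟩ := (Finset.mem_filter.mp hx).2
          rfl
      rw [hV, Finset.sum_smul]
      refine Finset.sum_congr rfl fun x hx => ?_
      obtain ⟨rfl⟩ := (Finset.mem_filter.mp hx).2
      simp only [nsmul_eq_mul, Nat.cast_mul]
      ring
    · rintro ⟨b, a⟩ h
      simp only [Finset.mem_product, Finset.HasAntidiagonal.mem_antidiagonal] at h ⊢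
      rw [← h.1, ← h.2]
      abel

theorem coeff_coeff_taylor (p : MvPowerSeries σ R) (α β : σ →₀ ℕ) :
    coeff α (coeff β (taylor σ R p)) =
      (∏ i, (α i + β i).choose (α i)) • coeff (α + β) p := rfl

theorem taylor_C (r : R) : taylor σ R (C r) = C (C r) := by
  classical
  refine MvPowerSeries.ext fun β => MvPowerSeries.ext fun α => ?_
  rw [coeff_coeff_taylor]
  simp only [coeff_C, add_eq_zero, apply_ite (coeff α), map_zero]
  by_cases hα : α = 0 <;> by_cases hβ : β = 0 <;> simp [hα, hβ]

theorem taylor_X (i : σ) : taylor σ R (X i) = C (X i) + X i := by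
  classical
  refine MvPowerSeries.ext fun β => MvPowerSeries.ext fun α => ?_
  rw [coeff_coeff_taylor, map_add, map_add]
  simp only [coeff_C, coeff_X, apply_ite (coeff α), map_zero, coeff_one]
  by_cases h : α + β = Finsupp.single i 1
  · have hd : α.degree + β.degree = 1 := by
      rw [← map_add, h, Finsupp.degree_single]
    by_cases hα : α = 0
    · subst hα
      rw [zero_add] at h
      subst h
      simp
    · have hβ : β = 0 := by
        rw [← Finsupp.degree_eq_zero_iff] at hα ⊢
        omega
      subst hβ
      rw [add_zero] at h
      subst h
      simp
  · rw [if_neg h, smul_zero]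
    by_cases hβ : β = 0
    · subst hβ
      rw [add_zero] at h
      have : (0 : σ →₀ ℕ) ≠ Finsupp.single i 1 := by simp [eq_comm]
      simp [h, this]
    · by_cases hα : α = 0
      · subst hα
        rw [zero_add] at h
        simp [h, hβ]
      · simp [hα, hβ]

end MvPowerSeries

/-! ### Iterativity as an equality of ring homomorphisms -/

namespace HigherDerivation

open MvPowerSeries

variable {σ : Type w} {R : Type v} [CommRing R]

/-- Comparing the coefficients of `T^α U^β` gives the iteration rule. In this form the rule can be
checked on `K` and `t` alone, by rigidity. -/
theorem isIterative_of_map_comp_eq [Fintype σ] (ψ : HigherDerivation σ R)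
    (h : (MvPowerSeries.map ψ.toRingHom).comp ψ.toRingHom = (taylor σ R).comp ψ.toRingHom) :
    ψ.IsIterative := by
  intro α β r
  have h1 := congrArg (fun f => coeff α (coeff β (f r))) h
  simpa [component, coeff_coeff_taylor] using h1

theorem map_eq_taylor_of_eq_C [Fintype σ] {ψ : HigherDerivation σ R} {r : R}
    (h : ψ.toRingHom r = C r) :
    MvPowerSeries.map ψ.toRingHom (ψ.toRingHom r) = taylor σ R (ψ.toRingHom r) := by
  rw [h, map_C, h, taylor_C]

theorem map_eq_taylor_of_eq_C_add_X [Fintype σ] {ψ : HigherDerivation σ R} {r : R} {i : σ}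
    (h : ψ.toRingHom r = C r + X i) :
    MvPowerSeries.map ψ.toRingHom (ψ.toRingHom r) = taylor σ R (ψ.toRingHom r) := by
  have h1 : MvPowerSeries.map ψ.toRingHom (C r + X i) = C (C r + X i) + X i := by
    rw [map_add, map_C, map_X, h]
  rw [h, h1, map_add, map_add, taylor_C, taylor_X, add_assoc]

theorem constantCoeff_constantCoeff_map (ψ : HigherDerivation σ R) (r : R) :
    constantCoeff (constantCoeff (MvPowerSeries.map ψ.toRingHom (ψ.toRingHom r))) = r := by
  rw [constantCoeff_map, ψ.constantCoeff_apply, ψ.constantCoeff_apply]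

theorem constantCoeff_constantCoeff_taylor [Fintype σ] (ψ : HigherDerivation σ R) (r : R) :
    constantCoeff (constantCoeff (taylor σ R (ψ.toRingHom r))) = r := by
  refine Eq.trans ?_ (ψ.constantCoeff_apply r)
  simpa using coeff_coeff_taylor (ψ.toRingHom r) 0 0

end HigherDerivation

/-! ### First-order components, values on generators, restriction -/

namespace HigherDerivation

open MvPowerSeries

variable {σ : Type w}

/-- The first order component in the variable `T_j`, as a derivation over a ring of constants. -/
noncomputable def derivation {K : Type u} {R : Type v} [CommRing K] [CommRing R] [Algebra K R]
    (θ : HigherDerivation σ R)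
    (hK : ∀ c : K, θ.toRingHom (algebraMap K R c) = C (algebraMap K R c)) (j : σ) :
    Derivation K R R :=
  Derivation.mk'
    { toFun := θ.component (Finsupp.single j 1)
      map_add' := fun x y => by simp [component]
      map_smul' := fun c x => by
        simp [component, Algebra.smul_def, hK] }
    fun x y => by
      classical
      have h0 : ∀ r, coeff (0 : σ →₀ ℕ) (θ.toRingHom r) = r := θ.constantCoeff_apply
      change coeff (Finsupp.single j 1) (θ.toRingHom (x * y)) =
        x • coeff (Finsupp.single j 1) (θ.toRingHom y) +
          y • coeff (Finsupp.single j 1) (θ.toRingHom x)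
      rw [map_mul, coeff_mul, Finsupp.antidiagonal_single]
      simp [Finset.Nat.antidiagonal_succ, h0, mul_comm]

theorem extends_polynomial_iff {K : Type u} {R : Type v} [CommRing K] [CommRing R] [Algebra K R]
    {t : σ → R} {ψ : HigherDerivation σ R} :
    Extends (MvPolynomial.aeval t : MvPolynomial σ K →ₐ[K] R).toRingHom (polynomial σ K) ψ ↔
      (∀ c : K, ψ.toRingHom (algebraMap K R c) = C (algebraMap K R c)) ∧
      ∀ i, ψ.toRingHom (t i) = C (t i) + X i := by
  rw [extends_iff]
  constructor
  · intro h
    exact ⟨fun c => by simpa [polynomial] using h (MvPolynomial.C c),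
      fun i => by simpa [polynomial] using h (MvPolynomial.X i)⟩
  · rintro ⟨hK, ht⟩ r
    refine congrArg (fun f => f r) (MvPolynomial.ringHom_ext
      (f := ψ.toRingHom.comp (MvPolynomial.aeval t : MvPolynomial σ K →ₐ[K] R).toRingHom)
      (g := (MvPowerSeries.map (MvPolynomial.aeval t : MvPolynomial σ K →ₐ[K] R).toRingHom).comp
        (polynomial σ K).toRingHom) ?_ ?_)
    · intro c
      simp [polynomial, hK]
    · intro i
      simp [polynomial, ht]

theorem _root_.MvPowerSeries.map_injective {R : Type*} {S : Type*} [CommRing R] [CommRing S]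
    {f : R →+* S} (hf : Function.Injective f) :
    Function.Injective (MvPowerSeries.map (σ := σ) f) := fun p q hpq => by
  ext α
  apply hf
  rw [← coeff_map, ← coeff_map, hpq]

/-- Restriction of a higher derivation to a stable subring. -/
noncomputable def restrict {S : Type v} [CommRing S] (θ : HigherDerivation σ S) {R : Type u}
    [CommRing R] (f : R →+* S) (hf : Function.Injective f)
    (h : ∀ α r, ∃ r', f r' = θ.component α (f r)) : HigherDerivation σ R :=
  have hex : ∀ r, ∃ p, MvPowerSeries.map f p = θ.toRingHom (f r) := fun r =>
    ⟨fun α => (h α r).choose, MvPowerSeries.ext fun α => (h α r).choose_spec⟩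
  have hg : ∀ r, MvPowerSeries.map f (hex r).choose = θ.toRingHom (f r) := fun r =>
    (hex r).choose_spec
  have hinj := MvPowerSeries.map_injective (σ := σ) hf
  { toRingHom :=
      { toFun := fun r => (hex r).choose
        map_one' := hinj (by rw [hg]; simp)
        map_zero' := hinj (by rw [hg]; simp)
        map_add' := fun x y => hinj (by rw [hg, map_add, map_add, map_add, hg, hg])
        map_mul' := fun x y => hinj (by rw [hg, map_mul, map_mul, map_mul, hg, hg]) }
    constantCoeff_apply := fun r => hf <| by
      have h1 := congrArg MvPowerSeries.constantCoeff (hg r)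
      rwa [constantCoeff_map, θ.constantCoeff_apply] at h1 }

theorem extends_restrict {S : Type v} [CommRing S] (θ : HigherDerivation σ S) {R : Type u}
    [CommRing R] (f : R →+* S) (hf : Function.Injective f)
    (h : ∀ α r, ∃ r', f r' = θ.component α (f r)) : Extends f (θ.restrict f hf h) θ :=
  extends_iff.mpr fun r => Eq.symm <| (⟨fun α => (h α r).choose,
    MvPowerSeries.ext fun α => (h α r).choose_spec⟩ :
      ∃ p, MvPowerSeries.map f p = θ.toRingHom (f r)).choose_spec

end HigherDerivation

/-! ### Separability: the Jacobian criterion and rigidity of lifts -/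

section Field

variable {K : Type u} {F : Type v} [Field K] [Field F] [Algebra K F]

/-- A derivation over `K` that vanishes on `s` vanishes on every element that is separable
over `K(s)`. -/
theorem Derivation.eq_zero_of_isSeparable_adjoin {L M : Type*} [Field L] [Algebra K L]
    [AddCommGroup M] [Module K M] [Module L M] [IsScalarTower K L M] (E : IntermediateField K F)
    [Algebra E L] [IsScalarTower K E L]
    (D : Derivation K L M) {s : Set F} (hE : E = IntermediateField.adjoin K s)
    (hD : ∀ x : E, (x : F) ∈ s → D (algebraMap E L x) = 0) {x : L} (hx : IsSeparable E x) :
    D x = 0 := by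
  -- The constants of `D` in `E` form a field containing `s`, hence are all of `E`; so `D` is
  -- `E`-linear, and applying it to the minimal equation of `x` gives `p'(x) D x = 0`.
  let Z : IntermediateField K E :=
    { carrier := {y | D (algebraMap E L y) = 0}
      mul_mem' := fun {a b} ha hb => by
        simp only [Set.mem_ofPred_eq] at ha hb ⊢
        simp [ha, hb]
      add_mem' := fun {a b} ha hb => by
        simp only [Set.mem_ofPred_eq] at ha hb ⊢
        simp [ha, hb]
      algebraMap_mem' := fun c => by
        simp only [Set.mem_ofPred_eq]
        rw [← IsScalarTower.algebraMap_apply, D.map_algebraMap]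
      inv_mem' := fun a ha => by
        simp only [Set.mem_ofPred_eq] at ha ⊢
        rw [map_inv₀, D.leibniz_inv, ha, smul_zero] }
  have hZ : ∀ y : E, D (algebraMap E L y) = 0 := by
    have hle : E ≤ IntermediateField.lift Z := by
      conv_lhs => rw [hE]
      rw [IntermediateField.adjoin_le_iff]
      intro y hy
      have hyE : y ∈ E := hE ▸ IntermediateField.subset_adjoin K s hy
      exact (IntermediateField.mem_lift (⟨y, hyE⟩ : E)).mpr (hD ⟨y, hyE⟩ hy)
    intro y
    exact (IntermediateField.mem_lift y).mp (hle y.2)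
  let _ : Module E M := Module.compHom M (algebraMap E L)
  have hsm : ∀ (y : E) (m : M), y • m = algebraMap E L y • m := fun _ _ => rfl
  have _ : IsScalarTower E L M := ⟨fun y a m => by
    rw [hsm, Algebra.smul_def, mul_smul]⟩
  let D' : Derivation E L M := Derivation.mk'
    { toFun := D
      map_add' := D.map_add
      map_smul' := fun y a => by
        change D (y • a) = y • D a
        rw [hsm, Algebra.smul_def, D.leibniz, hZ, smul_zero, add_zero] } D.leibniz
  have h1 : Polynomial.aeval x (minpoly E x).derivative • D' x = 0 := by
    rw [← Derivation.map_aeval, minpoly.aeval, map_zero]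
  rcases smul_eq_zero.mp h1 with h | h
  · exact absurd h (hx.aeval_derivative_ne_zero (minpoly.aeval E x))
  · exact h

/-- Jacobian criterion: if `F` is separable algebraic over `K(s)` and there are `K`-derivations of
`F` dual to `s` whose Jacobian at `t` is invertible, then `F` is separable algebraic over `K(t)`. -/
theorem isSeparable_adjoin_of_det_ne_zero {ι : Type*} [Fintype ι] [DecidableEq ι] {s t : ι → F}
    (hF : Algebra.IsSeparable (IntermediateField.adjoin K (Set.range s)) F)
    (d : ι → Derivation K F F) (hd : ∀ i j, d j (s i) = if i = j then 1 else 0)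
    (hJ : (Matrix.of fun i j => d j (t i)).det ≠ 0) :
    Algebra.IsSeparable (IntermediateField.adjoin K (Set.range t)) F := by
  set Es := IntermediateField.adjoin K (Set.range s) with hEs
  set Et := IntermediateField.adjoin K (Set.range t) with hEt
  -- The field `K(s, t)` splits the problem: `F` is separable over it because it contains `K(s)`,
  -- and it is finitely generated over `K(t)`, so the vanishing of its differentials suffices there.
  let L := IntermediateField.adjoin Et (Set.range s)
  have hsL : ∀ i, s i ∈ L := fun i => IntermediateField.subset_adjoin _ _ ⟨i, rfl⟩
  have htE : ∀ i, t i ∈ Et := fun i => IntermediateField.subset_adjoin _ _ ⟨i, rfl⟩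
  have hle : Es ≤ L.restrictScalars K := by
    rw [hEs, IntermediateField.adjoin_le_iff]
    rintro _ ⟨i, rfl⟩
    exact hsL i
  let _ : Algebra Es L := (IntermediateField.inclusion hle).toRingHom.toAlgebra
  have _ : IsScalarTower Es L F := IsScalarTower.of_algebraMap_eq fun _ => rfl
  have _ : IsScalarTower K L F := IsScalarTower.of_algebraMap_eq fun _ => rfl
  have _ : IsScalarTower K Es L := IsScalarTower.of_algebraMap_eq fun _ => rfl
  have hLF : Algebra.IsSeparable L F := Algebra.isSeparable_tower_top_of_isSeparable Es L F
  have hEsL : Algebra.IsSeparable Es L := Algebra.isSeparable_tower_bot_of_isSeparable Es L F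
  have hzero : ∀ D : Derivation Et L F, D = 0 := by
    intro D
    let sL : ι → L := fun i => ⟨s i, hsL i⟩
    -- Subtracting the combination of the `d j` with the same values on `s` leaves a derivation that
    -- kills `s`, hence all of `L`.
    let D' : Derivation K L F := D.restrictScalars K -
      ∑ j, D (sL j) • (d j).compAlgebraMap L
    have hD' : ∀ x : L, D' x = D x - ∑ j, D (sL j) * d j x := by
      intro x
      have e : (∑ j, D (sL j) • (d j).compAlgebraMap L) x = ∑ j, D (sL j) * d j x := by
        have h1 := map_sum (Derivation.coeFnAddMonoidHom (R := K) (A := L) (M := F))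
          (fun j => D (sL j) • (d j).compAlgebraMap L) Finset.univ
        refine (congrFun h1 x).trans ?_
        rw [Finset.sum_apply]
        rfl
      rw [← e]
      rfl
    have h0 : ∀ x : L, D' x = 0 := by
      intro x
      refine D'.eq_zero_of_isSeparable_adjoin Es (s := Set.range s) hEs ?_
        (Algebra.IsSeparable.isSeparable Es x)
      rintro ⟨y, hy⟩ ⟨i, rfl⟩
      have e : algebraMap Es L ⟨s i, hy⟩ = sL i := rfl
      rw [e, hD']
      simp [sL, hd]
    have hs0 : ∀ j, D (sL j) = 0 := by
      -- `D` kills `t i`, so evaluating `D' = 0` there puts the vector of the `D (sL j)` in the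
      -- kernel of the Jacobian.
      have hv : (Matrix.of fun i j => d j (t i)).mulVec (fun j => D (sL j)) = 0 := by
        ext i
        have h1 := h0 (algebraMap Et L ⟨t i, htE i⟩)
        rw [hD', D.map_algebraMap, zero_sub, neg_eq_zero] at h1
        rw [Pi.zero_apply, ← h1]
        exact Finset.sum_congr rfl fun j _ => mul_comm _ _
      exact congrFun (Matrix.eq_zero_of_mulVec_eq_zero hJ hv)
    ext x
    have h1 := h0 x
    rw [hD'] at h1
    simpa [hs0] using h1
  have hΩ : Subsingleton Ω[L⁄Et] := by
    refine subsingleton_of_forall_eq 0 fun ω => ?_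
    have hall : ∀ x, KaehlerDifferential.D Et L x = 0 := by
      intro x
      rw [← Module.forall_dual_apply_eq_zero_iff L]
      intro f
      have h1 := congrArg (fun D => D x)
        (hzero (((Algebra.linearMap L F).comp f).compDer (KaehlerDifferential.D Et L)))
      exact (algebraMap L F).injective (by simpa using h1)
    have h1 := KaehlerDifferential.span_range_derivation Et L
    have h2 : Set.range (KaehlerDifferential.D Et L) = {0} := by
      ext y
      constructor
      · rintro ⟨x, rfl⟩
        exact hall x
      · rintro rfl
        exact ⟨0, map_zero _⟩
    rw [h2, Submodule.span_zero_singleton] at h1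
    exact (Submodule.mem_bot L).mp (h1 ▸ Submodule.mem_top)
  have hu : Algebra.FormallyUnramified Et L := ⟨hΩ⟩
  have hfg : Algebra.EssFiniteType Et L :=
    IntermediateField.essFiniteType_iff.mpr
      (IntermediateField.fg_adjoin_of_finite (Set.finite_range s))
  have hEtL : Algebra.IsSeparable Et L := Algebra.FormallyUnramified.isSeparable Et L
  exact Algebra.IsSeparable.trans Et L F

open scoped IntermediateField.algebraAdjoinAdjoin in
-- The transcendence degree of `F` is the number of the `s i`; a family of that finite size over
-- which `F` is algebraic must be a transcendence basis.
theorem algebraicIndependent_of_isAlgebraic_adjoin {ι : Type*} [Finite ι] {s t : ι → F}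
    (hs : AlgebraicIndependent K s)
    (hsF : Algebra.IsAlgebraic (IntermediateField.adjoin K (Set.range s)) F)
    (htF : Algebra.IsAlgebraic (IntermediateField.adjoin K (Set.range t)) F) :
    AlgebraicIndependent K t := by
  have h1 : Algebra.IsAlgebraic (Algebra.adjoin K (Set.range s)) F :=
    (IsFractionRing.comap_isAlgebraic_iff (K := IntermediateField.adjoin K (Set.range s))).mpr hsF
  have h2 : Algebra.IsAlgebraic (Algebra.adjoin K (Set.range t)) F :=
    (IsFractionRing.comap_isAlgebraic_iff (K := IntermediateField.adjoin K (Set.range t))).mpr htF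
  have hb : IsTranscendenceBasis K s := hs.isTranscendenceBasis_iff_isAlgebraic.mpr h1
  exact (Algebra.IsAlgebraic.isTranscendenceBasis_of_lift_le_trdeg_of_finite K t hb.lift_cardinalMk_eq_trdeg.le).1

/-- Ring homomorphisms from `R ⊆ F` into a domain that lift the inclusion and agree on a subring
`A` are equal if `F` is separable algebraic over the fraction field of `A`. -/
theorem RingHom.eq_of_comp_eq_of_isSeparable {A E R B : Type*} [CommRing A] [Field E] [CommRing R]
    [CommRing B] [IsDomain B] [Algebra A E] [IsFractionRing A E] [Algebra A R] [Algebra R F]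
    [Algebra A F] [Algebra E F] [IsScalarTower A E F] [IsScalarTower A R F]
    [Algebra.IsSeparable E F] (hRF : Function.Injective (algebraMap R F))
    (c : B →+* F) {f g : R →+* B}
    (hf : c.comp f = algebraMap R F) (hg : c.comp g = algebraMap R F)
    (hfg : f.comp (algebraMap A R) = g.comp (algebraMap A R)) : f = g := by
  ext r
  set x := algebraMap R F r with hx
  -- Clearing denominators moves the separable equation of `x` to `A`, where `f` and `g` agree; both
  -- `f r` and `g r` are then roots of the same `q` over `B`.
  let p := IsLocalization.integerNormalization (nonZeroDivisors A) (minpoly E x)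
  obtain ⟨b, hbA, hb⟩ := IsLocalization.integerNormalization_spec (nonZeroDivisors A)
    (minpoly E x)
  have hb0 : algebraMap A E b ≠ 0 := (IsLocalization.map_units E ⟨b, hbA⟩).ne_zero
  have hb' : p.map (algebraMap A E) = Polynomial.C (algebraMap A E b) * minpoly E x := by
    rw [← Polynomial.smul_eq_C_mul, algebraMap_smul]
    exact hb
  have hp0 : Polynomial.aeval x p = 0 := by
    rw [← Polynomial.aeval_map_algebraMap E, hb', map_mul, minpoly.aeval, mul_zero]
  have hp1 : Polynomial.aeval x p.derivative ≠ 0 := by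
    rw [← Polynomial.aeval_map_algebraMap E, ← Polynomial.derivative_map, hb',
      Polynomial.derivative_C_mul, map_mul, Polynomial.aeval_C]
    exact mul_ne_zero ((map_ne_zero _).mpr hb0)
      ((Algebra.IsSeparable.isSeparable E x).aeval_derivative_ne_zero (minpoly.aeval E x))
  have hpr : Polynomial.aeval r p = 0 := by
    apply hRF
    rw [← Polynomial.aeval_algebraMap_apply, ← hx, hp0, map_zero]
  let q : Polynomial B := p.map (f.comp (algebraMap A R))
  have hqf : q.eval (f r) = 0 := by
    rw [Polynomial.eval_map, ← Polynomial.hom_eval₂, ← Polynomial.aeval_def, hpr, map_zero]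
  have hqg : q.eval (g r) = 0 := by
    simp only [q, hfg]
    rw [Polynomial.eval_map, ← Polynomial.hom_eval₂, ← Polynomial.aeval_def, hpr, map_zero]
  obtain ⟨k, hk⟩ := q.binomExpansion (f r) (g r - f r)
  rw [add_sub_cancel, hqf, hqg, zero_add, pow_two, ← mul_assoc, ← add_mul, eq_comm,
    mul_eq_zero] at hk
  have hcf : ∀ y, c (f y) = algebraMap R F y := fun y => congrArg (fun h => h y) hf
  have hcg : ∀ y, c (g y) = algebraMap R F y := fun y => congrArg (fun h => h y) hg
  rcases hk with h | h
  -- With `δ = g r - f r`, the expansion reads `(q'(f r) + k δ) δ = 0`. As `c` kills `δ`, it sends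
  -- the first factor to `p'(x) ≠ 0`.
  · exfalso
    apply hp1
    have h1 := congrArg c h
    rw [map_add, map_mul, map_sub, hcf, hcg, sub_self, mul_zero, add_zero, map_zero] at h1
    rw [← h1]
    simp only [q, Polynomial.derivative_map, Polynomial.eval_map, Polynomial.hom_eval₂, hcf,
      ← RingHom.comp_assoc, hf, ← IsScalarTower.algebraMap_eq A R F]
    rfl
  · exact (sub_eq_zero.mp h).symm

end Field

open scoped IntermediateField.algebraAdjoinAdjoin in
/-- Ring homomorphisms from `R ⊆ F` into a domain that lift the inclusion and agree on `K` and `t`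
are equal if `F` is separable algebraic over `K(t)`. -/
theorem Subalgebra.ringHom_eq_of_isSeparable_adjoin {K : Type u} {F : Type v} [Field K] [Field F]
    [Algebra K F] {R : Subalgebra K F} {ι B : Type*} [CommRing B] [IsDomain B] {t : ι → R}
    (ht : Algebra.IsSeparable (IntermediateField.adjoin K (Set.range fun i => (t i : F))) F)
    (c : B →+* F) {f g : R →+* B}
    (hf : ∀ r, c (f r) = r) (hg : ∀ r, c (g r) = r)
    (hK : ∀ a : K, f (algebraMap K R a) = g (algebraMap K R a)) (hfg : ∀ i, f (t i) = g (t i)) :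
    f = g := by
  let A := Algebra.adjoin K (Set.range fun i => (t i : F))
  have hA : A ≤ R := Algebra.adjoin_le (by rintro _ ⟨i, rfl⟩; exact (t i).2)
  let _ : Algebra A R := (Subalgebra.inclusion hA).toRingHom.toAlgebra
  have _ : IsScalarTower A R F := IsScalarTower.of_algebraMap_eq fun _ => rfl
  refine RingHom.eq_of_comp_eq_of_isSeparable (A := A)
    (E := IntermediateField.adjoin K (Set.range fun i => (t i : F))) (F := F)
    Subtype.val_injective c (RingHom.ext hf) (RingHom.ext hg) ?_
  have key : ∀ (x : F) (hx : x ∈ A), f ⟨x, hA hx⟩ = g ⟨x, hA hx⟩ := by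
    intro x hx
    induction hx using Algebra.adjoin_induction with
    | mem x hx =>
      obtain ⟨i, rfl⟩ := hx
      exact hfg i
    | algebraMap a => exact hK a
    | add x y hx hy ihx ihy =>
      have e : (⟨x + y, hA (A.add_mem hx hy)⟩ : R) = ⟨x, hA hx⟩ + ⟨y, hA hy⟩ := rfl
      rw [e, map_add, map_add, ihx, ihy]
    | mul x y hx hy ihx ihy =>
      have e : (⟨x * y, hA (A.mul_mem hx hy)⟩ : R) = ⟨x, hA hx⟩ * ⟨y, hA hy⟩ := rfl
      rw [e, map_mul, map_mul, ihx, ihy]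
  exact RingHom.ext fun x => key x x.2

/-! ### The main theorem -/

open MvPowerSeries in
theorem theorem4p5 {K : Type u} {F : Type v} [Field K] [Field F] [Algebra K F] (n : ℕ)
    (s : Fin n → F) (hs : AlgebraicIndependent K s)
    (hF : Algebra.IsSeparable (IntermediateField.adjoin K (Set.range s)) F)
    (R : Subalgebra K F)
    (hR : ∀ (α : Fin n →₀ ℕ), ∀ r ∈ R,
      (HigherDerivation.ofEtale s (formallyEtale_aeval_of_isSeparable hs hF)).component α r ∈ R)
    (t : Fin n → R)
    (ht : ∃ u : Rˣ, ((u : R) : F) =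
      ((HigherDerivation.ofEtale s (formallyEtale_aeval_of_isSeparable hs hF)).jacobian
        (fun i => (t i : F))).det) :
    AlgebraicIndependent K t ∧
      ∃ ψ : HigherDerivation (Fin n) R,
        HigherDerivation.Extends (MvPolynomial.aeval t : MvPolynomial (Fin n) K →ₐ[K] R).toRingHom
          (HigherDerivation.polynomial (Fin n) K) ψ ∧
        ψ.IsIterative ∧
        ∀ ψ' : HigherDerivation (Fin n) R,
          HigherDerivation.Extends
            (MvPolynomial.aeval t : MvPolynomial (Fin n) K →ₐ[K] R).toRingHom
            (HigherDerivation.polynomial (Fin n) K) ψ' → ψ' = ψ := by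
  set θ := HigherDerivation.ofEtale s (formallyEtale_aeval_of_isSeparable hs hF) with hθ
  obtain ⟨hθK, hθs⟩ := HigherDerivation.extends_polynomial_iff.mp
    (HigherDerivation.extends_ofEtale s (formallyEtale_aeval_of_isSeparable hs hF))
  rw [← hθ] at hθK hθs
  obtain ⟨u, hu⟩ := ht
  have htF : Algebra.IsSeparable
      (IntermediateField.adjoin K (Set.range fun i => (t i : F))) F := by
    refine isSeparable_adjoin_of_det_ne_zero hF (θ.derivation hθK) (fun i j => ?_) ?_
    · change coeff (Finsupp.single j 1) (θ.toRingHom (s i)) = _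
      have hC : coeff (Finsupp.single j 1) (C (s i) : MvPowerSeries (Fin n) F) = 0 := by
        rw [coeff_C, if_neg]; simp
      rw [hθs, map_add, hC, zero_add, coeff_X]
      simp [Finsupp.single_left_inj, eq_comm]
    · change (θ.jacobian fun i => (t i : F)).det ≠ 0
      rw [← hu]
      exact (u.isUnit.map R.val).ne_zero
  have hind : AlgebraicIndependent K t :=
    AlgebraicIndependent.of_comp R.val
      (algebraicIndependent_of_isAlgebraic_adjoin (t := fun i => (t i : F)) hs
        inferInstance inferInstance)
  have hstab : ∀ α (r : R), ∃ r', R.val.toRingHom r' = θ.component α (R.val.toRingHom r) :=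
    fun α r => ⟨⟨_, hR α r r.2⟩, rfl⟩
  let θR : HigherDerivation (Fin n) R := θ.restrict R.val.toRingHom Subtype.val_injective hstab
  have hext : HigherDerivation.Extends R.val.toRingHom θR θ :=
    HigherDerivation.extends_restrict θ R.val.toRingHom Subtype.val_injective hstab
  have hJ : IsUnit (θR.jacobian t).det := by
    have h1 : R.val.toRingHom (θR.jacobian t).det = (θ.jacobian fun i => (t i : F)).det := by
      rw [RingHom.map_det]
      congr 1
      ext i j
      exact (hext _ _).symm
    -- Invertibility must hold in `R`, not only in `F`, for the inverse Jacobian to have entries in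
    -- `R`.
    have h2 : (θR.jacobian t).det = u := Subtype.val_injective (h1.trans hu.symm)
    exact h2 ▸ u.isUnit
  have hθRK : ∀ c : K, θR.toRingHom (algebraMap K R c) = C (algebraMap K R c) := by
    intro c
    refine MvPowerSeries.map_injective (f := R.val.toRingHom) Subtype.val_injective ?_
    rw [← HigherDerivation.extends_iff.mp hext, map_C]
    exact hθK c
  obtain ⟨ψ, hψt, hψC⟩ :=
    HigherDerivation.exists_higherDerivation_of_isUnit_det_jacobian θR t hJ
  have hψK : ∀ c : K, ψ.toRingHom (algebraMap K R c) = C (algebraMap K R c) :=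
    fun c => hψC _ (hθRK c)
  refine ⟨hind, ψ, HigherDerivation.extends_polynomial_iff.mpr ⟨hψK, hψt⟩, ?_, ?_⟩
  · have : IsDomain (MvPowerSeries (Fin n) R) := NoZeroDivisors.to_isDomain _
    have : IsDomain (MvPowerSeries (Fin n) (MvPowerSeries (Fin n) R)) :=
      NoZeroDivisors.to_isDomain _
    refine ψ.isIterative_of_map_comp_eq ?_
    -- Both homomorphisms to `R⟦T⟧⟦U⟧` reduce to the inclusion at `T = U = 0`, fix `K`, and send `t
    -- i` to `t i + T_i + U_i`.
    refine Subalgebra.ringHom_eq_of_isSeparable_adjoin htF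
      ((R.val.toRingHom.comp constantCoeff).comp constantCoeff) (fun r => ?_) (fun r => ?_)
      (fun a => ?_) (fun i => ?_)
    · exact congrArg Subtype.val (ψ.constantCoeff_constantCoeff_map r)
    · exact congrArg Subtype.val (ψ.constantCoeff_constantCoeff_taylor r)
    · exact HigherDerivation.map_eq_taylor_of_eq_C (hψK a)
    · exact HigherDerivation.map_eq_taylor_of_eq_C_add_X (hψt i)
  · intro ψ' hψ'
    obtain ⟨hK', ht'⟩ := HigherDerivation.extends_polynomial_iff.mp hψ'
    have : IsDomain (MvPowerSeries (Fin n) R) := NoZeroDivisors.to_isDomain _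
    have h : ψ'.toRingHom = ψ.toRingHom := by
      refine Subalgebra.ringHom_eq_of_isSeparable_adjoin htF
        (R.val.toRingHom.comp constantCoeff) (fun r => congrArg Subtype.val (ψ'.constantCoeff_apply r))
        (fun r => congrArg Subtype.val (ψ.constantCoeff_apply r)) (fun a => ?_) (fun i => ?_)
      · rw [hK', hψK]
      · rw [ht', hψt]
    cases ψ'
    cases ψ
    congr 1
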